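/- Let $\hbar=1$ and let $\mathcal H_B^{(A)}=\mathcal H_C^{(A)}=L^2(\mathbb R)$, so that $\mathcal H_B^{(A)}\otimes\mathcal H_C^{(A)}=L^2(\mathbb R^2)$ with wave functions $\psi(x_B,x_C)$. Let $\hat x_C$ be the position operator of $C$ (multiplication by $x_C$ on its maximal domain) and $\hat p_B=-i\,\partial/\partial x_B$ the momentum operator of $B$. Let $\mathcal P_{AC}:\mathcal H_B^{(A)}\otimes\mathcal H_C^{(A)}\to\mathcal H_A^{(C)}\otimes\mathcal H_B^{(C)}=L^2(\mathbb R^2)$ be the parity-swap $(\mathcal P_{AC}\psi)(q_A,q_B)=\psi(x_B=q_B,\,x_C=-q_A)$. For $P\in\mathbb R$ put $\hat S^P_{A\to C}=\mathcal P_{AC}\,e^{i\hat x_C(\hat p_B-P)}$, i.e. $e^{i\hat x_C(\hat p_B-P)}$ acts by $\psi(x_B,x_C)\mapsto e^{-ix_CP}\,\psi(x_B+x_C,x_C)$, and $\hat S_{A\to C}=\hat S^0_{A\to C}$. A bounded operator $\hat O$ on $\mathcal H_B^{(A)}\otimes\mathcal H_C^{(A)}$ is called invariant under $\hat S^P_{A\to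 C}$ if $\hat S^P_{A\to C}\,\hat O\,(\hat S^P_{A\to C})^\dagger=\mathcal P_{AC}\,\hat O\,\mathcal P_{AC}^\dagger$. **Theorem.** Let $\hat O=\sum_{k=1}^n\lambda_k\,\hat O_B^{(k)}\otimes\hat O_C^{(k)}$ be a bounded Hermitian operator on $\mathcal H_B^{(A)}\otimes\mathcal H_C^{(A)}$, where $n$ is finite, $\lambda_k>0$, and $(\hat O_B^{(k)})_k$ and $(\hat O_C^{(k)})_k$ are linearly independent families of bounded operators on $L^2(\mathbb R)$ (as is the case in a Schmidt decomposition, where these families are orthonormal for the trace inner product). Suppose that $\hat O$ is invariant under the standard transformation $\hat S_{A\to C}$. Then, for every $P\neq0$, $\hat O$ is invariant under the generalised transformation $\hat S^P_{A\to C}$ if and only if $[\hat x_C,\hat O_C^{(k)}]=0$ for all $k\in\{1,\dots,n\}$, meaning that $\hat O_C^{(k)}$ maps the domain of $\hat x_C$ into itself and $\hat x_C\hat O_C^{(k)}f=\hat O_C^{(k)}\hat x_Cf$ for every $f$ in that domain. -/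

import Mathlib

open MeasureTheory

noncomputable section

namespace QRF

/-- The Hilbert space `L²(ℝ)` of one particle on the line, in the position representation. -/
abbrev HOne : Type := Lp ℂ 2 (volume : Measure ℝ)

/-- The Hilbert space `L²(ℝ²)` of two particles on the line, in the position representation; it is
the Hilbert tensor product `L²(ℝ) ⊗ L²(ℝ)`, with product vectors given by `prodVec` below. -/
abbrev HTwo : Type := Lp ℂ 2 (volume : Measure (ℝ × ℝ))

/-- State space of `B` and `C` relative to `A`; wave functions `ψ (x_B, x_C)`. -/
abbrev HBC : Type := HTwo

/-- State space of `A` and `B` relative to `C`; wave functions `ψ (q_A, q_B)`. -/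
abbrev HAB : Type := HTwo

theorem memLp_prodVec (f g : HOne) :
    MemLp (fun z : ℝ × ℝ => f z.1 * g z.2) 2 (volume : Measure (ℝ × ℝ)) := by
  have hf := Lp.memLp f
  have hg := Lp.memLp g
  have hm : AEStronglyMeasurable (fun z : ℝ × ℝ => f z.1 * g z.2)
      (volume : Measure (ℝ × ℝ)) := hf.1.comp_fst.mul hg.1.comp_snd
  rw [memLp_two_iff_integrable_sq_norm hm]
  have h := Integrable.mul_prod ((memLp_two_iff_integrable_sq_norm hf.1).1 hf)
    ((memLp_two_iff_integrable_sq_norm hg.1).1 hg)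
  simp only [norm_mul, mul_pow]
  exact h

/-- The product vector `f ⊗ g`, i.e. the wave function `(y, x) ↦ f y * g x`. -/
def prodVec (f g : HOne) : HTwo := (memLp_prodVec f g).toLp _

/-- `O = ∑ₖ λₖ (O_B⁽ᵏ⁾ ⊗ O_C⁽ᵏ⁾)` is a decomposition of Schmidt type of the bounded operator `O`.

The identity of operators is expressed on product vectors, whose span is dense, so that it
determines `O`. The coefficients are positive. The families `O_B⁽ᵏ⁾` and `O_C⁽ᵏ⁾` are linearly
independent; this is implied by orthonormality for the trace inner product, and unlike the latter
it makes sense for bounded operators, such as the parity operator, that are not Hilbert–Schmidt. -/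
structure IsSchmidtDecomposition (O : HBC →L[ℂ] HBC) {n : ℕ} (lam : Fin n → ℝ)
    (OB OC : Fin n → (HOne →L[ℂ] HOne)) : Prop where
  coeff_pos : ∀ k, 0 < lam k
  linearIndependent_left : LinearIndependent ℂ OB
  linearIndependent_right : LinearIndependent ℂ OC
  apply_prodVec : ∀ f g : HOne,
    O (prodVec f g) = ∑ k, (lam k : ℂ) • prodVec (OB k f) (OC k g)

/-- The position operator `x̂` on `L²(ℝ)`: multiplication by `x` on its maximal domain
`{f | x ↦ x * f x is square integrable}`. -/
def position : HOne →ₗ.[ℂ] HOne where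
  domain :=
    { carrier := {f | MemLp (fun x : ℝ => (x : ℂ) * f x) 2 volume}
      add_mem' := by
        intro f g hf hg
        refine (memLp_congr_ae ?_).1 (MemLp.add hf hg)
        filter_upwards [Lp.coeFn_add f g] with x hx
        simp only [Pi.add_apply, hx]
        ring
      zero_mem' := by
        refine (memLp_congr_ae ?_).1 (MemLp.zero' (ε := ℂ))
        filter_upwards [Lp.coeFn_zero ℂ 2 (volume : Measure ℝ)] with x hx
        rw [hx, Pi.zero_apply, mul_zero]
      smul_mem' := by
        intro c f hf
        refine (memLp_congr_ae ?_).1 (MemLp.const_smul hf c)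
        filter_upwards [Lp.coeFn_smul c f] with x hx
        simp only [Pi.smul_apply, hx, smul_eq_mul]
        ring }
  toFun :=
    { toFun := fun f => MemLp.toLp (fun x : ℝ => (x : ℂ) * (f : HOne) x) f.2
      map_add' := by
        intro f g
        rw [← MemLp.toLp_add]
        refine MemLp.toLp_congr _ _ ?_
        filter_upwards [Lp.coeFn_add (f : HOne) (g : HOne)] with x hx
        simp only [Submodule.coe_add, Pi.add_apply, hx]
        ring
      map_smul' := by
        intro c f
        rw [RingHom.id_apply, ← MemLp.toLp_const_smul]
        refine MemLp.toLp_congr _ _ ?_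
        filter_upwards [Lp.coeFn_smul c (f : HOne)] with x hx
        simp only [Submodule.coe_smul, Pi.smul_apply, hx, smul_eq_mul]
        ring }

/-- `[X, T] = 0` for a possibly unbounded operator `X` and a bounded operator `T`: `T` maps the
domain of `X` into itself and `X T f = T X f` there. -/
def CommutesWith (X : HOne →ₗ.[ℂ] HOne) (T : HOne →L[ℂ] HOne) : Prop :=
  ∀ f : X.domain, ∃ h : T (f : HOne) ∈ X.domain, X ⟨T (f : HOne), h⟩ = T (X f)

theorem memLp_phase (P : ℝ) (f : HBC) :
    MemLp (fun z : ℝ × ℝ => Complex.exp (-(Complex.I * (z.2 : ℂ) * (P : ℂ))) * f z) 2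
      (volume : Measure (ℝ × ℝ)) := by
  have hf := Lp.memLp f
  have hc : Continuous fun z : ℝ × ℝ => Complex.exp (-(Complex.I * (z.2 : ℂ) * (P : ℂ))) := by
    fun_prop
  refine hf.of_le (hc.aestronglyMeasurable.mul hf.1) (Filter.Eventually.of_forall fun z => ?_)
  rw [norm_mul, Complex.norm_exp]
  simp

/-- The unitary `e^{-i x̂_C P}`: multiplication of `ψ (x_B, x_C)` by the phase `e^{-i x_C P}`. -/
def phase (P : ℝ) : HBC →ₗᵢ[ℂ] HBC where
  toFun f := (memLp_phase P f).toLp _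
  map_add' := by
    intro f g
    rw [← MemLp.toLp_add]
    refine MemLp.toLp_congr _ _ ?_
    filter_upwards [Lp.coeFn_add f g] with x hx
    simp only [Pi.add_apply, hx]
    ring
  map_smul' := by
    intro c f
    rw [RingHom.id_apply, ← MemLp.toLp_const_smul]
    refine MemLp.toLp_congr _ _ ?_
    filter_upwards [Lp.coeFn_smul c f] with x hx
    simp only [Pi.smul_apply, hx, smul_eq_mul]
    ring
  norm_map' := by
    intro f
    change ‖(memLp_phase P f).toLp _‖ = ‖f‖
    rw [Lp.norm_toLp, Lp.norm_def]
    congr 1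
    refine eLpNorm_congr_norm_ae (Filter.Eventually.of_forall fun z => ?_)
    rw [norm_mul, Complex.norm_exp]
    simp

theorem measurePreserving_shear :
    MeasurePreserving (fun z : ℝ × ℝ => (z.1 + z.2, z.2)) volume volume :=
  measurePreserving_add_prod (volume : Measure ℝ) (volume : Measure ℝ)

/-- The quantum-controlled translation `e^{i x̂_C p̂_B}`. As `p̂_B = -i ∂/∂x_B` generates the
translations, `(e^{i a p̂_B} φ) (x_B) = φ (x_B + a)`, one has
`(e^{i x̂_C p̂_B} ψ) (x_B, x_C) = ψ (x_B + x_C, x_C)`. -/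
def controlledTranslation : HBC →ₗᵢ[ℂ] HBC :=
  Lp.compMeasurePreservingₗᵢ ℂ (fun z : ℝ × ℝ => (z.1 + z.2, z.2)) measurePreserving_shear

theorem measurePreserving_paritySwap :
    MeasurePreserving (fun z : ℝ × ℝ => (z.2, -z.1)) volume volume := by
  have h1 : MeasurePreserving (fun z : ℝ × ℝ => (-z.1, z.2)) volume volume :=
    (Measure.measurePreserving_neg (volume : Measure ℝ)).prod
      (MeasurePreserving.id (volume : Measure ℝ))
  have h2 : MeasurePreserving (Prod.swap : ℝ × ℝ → ℝ × ℝ) volume volume :=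
    Measure.measurePreserving_swap
  exact h2.comp h1

/-- The parity-swap operator `𝒫_AC = ∫ dx |-x⟩_A ⟨x|_C` from the state space relative to `A` to the
state space relative to `C`: `(𝒫_AC ψ) (q_A, q_B) = ψ (x_B = q_B, x_C = -q_A)`. -/
def paritySwap : HBC →L[ℂ] HAB :=
  (Lp.compMeasurePreservingₗᵢ ℂ (fun z : ℝ × ℝ => (z.2, -z.1))
    measurePreserving_paritySwap).toContinuousLinearMap

/-- The generalised transformation `Ŝ^P_{A→C} = 𝒫_AC e^{i x̂_C (p̂_B - P)}` for total momentum `P`;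
the commuting factors `e^{i x̂_C p̂_B}` and `e^{-i x̂_C P}` of the exponential are written out. -/
def transform (P : ℝ) : HBC →L[ℂ] HAB :=
  paritySwap ∘L (controlledTranslation.toContinuousLinearMap ∘L (phase P).toContinuousLinearMap)

/-- The standard transformation `Ŝ_{A→C} = 𝒫_AC e^{i x̂_C p̂_B}`. -/
def standardTransform : HBC →L[ℂ] HAB :=
  paritySwap ∘L controlledTranslation.toContinuousLinearMap

/-- `O` is invariant under the transformation `S`: `S O S† = 𝒫_AC O 𝒫_AC†`. -/
def IsInvariant (S : HBC →L[ℂ] HAB) (O : HBC →L[ℂ] HBC) : Prop :=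
  S ∘L O ∘L ContinuousLinearMap.adjoint S =
    paritySwap ∘L O ∘L ContinuousLinearMap.adjoint paritySwap

end QRF

end

open MeasureTheory

namespace QRF

open Filter Topology

/-! Invariance under `standardTransform` says that O commutes with the unitary e^{i x_C p_B}.
Granted this, invariance under `transform P` says that O commutes with e^{-i x_C P}, hence, the O_B
being linearly independent, that every O_C commutes with e^{-iPx} (`phase_comm_iff`). Commutation
with x implies this, since the exponential is a limit of powers of resolvents of x.

Conversely, commuting with e^{-iPx} still allows O_C to connect points that differ by a multiple mL
of L = 2π/|P|, and this has to be excluded for m ≠ 0. Let φ and f be supported in intervals of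
length L displaced by mL. Comparing matrix elements of O e^{i x_C p_B} = e^{i x_C p_B} O and of O =
O†, one Fourier mode at a time, shows that for almost every x the operator B(x) = ∑ λ_k conj(φ(x))
(O_C f)(x) O_B satisfies T_x B(x) = B(x) T_{x+mL}, where T is translation. The ratios x/(x+mL)
differ for different x, and nonzero intertwiners with different ratios are linearly independent,
because translations tend weakly to zero (`linearIndependent_of_intertwines`). All B(x) lie in the
finite-dimensional span of the O_B, so B(x) = 0 almost everywhere, and independence of the O_B gives
conj(φ) O_C f = 0 (`inner_apply_eq_zero`). Since the intervals may start anywhere, O_C commutes with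
the indicators of all of them, and these generate the functions of x (`position_of_blocks`). -/

/-! ### Bounded operators commuting with multiplication operators -/

/-- `T` commutes with multiplication by `h` on its maximal domain. -/
def CommutesWithMul (T : HOne →L[ℂ] HOne) (h : ℝ → ℂ) : Prop :=
  ∀ f g : HOne, (g : ℝ → ℂ) =ᵐ[volume] (fun x => h x * f x) →
    (T g : ℝ → ℂ) =ᵐ[volume] fun x => h x * T f x

theorem exists_coeFn_eq_mul {h : ℝ → ℂ} (hm : Measurable h) {C : ℝ} (hC : ∀ x, ‖h x‖ ≤ C)
    (f : HOne) : ∃ g : HOne, (g : ℝ → ℂ) =ᵐ[volume] fun x => h x * f x := by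
  have hf := Lp.memLp f
  have : MemLp (fun x => h x * f x) 2 volume := by
    refine hf.of_le_mul (c := C) (hm.aestronglyMeasurable.mul hf.1) (Eventually.of_forall fun x => ?_)
    rw [norm_mul]
    gcongr
    exact hC x
  exact ⟨this.toLp _, this.coeFn_toLp⟩

/-- The domain is encoded by the pair (f, g): a g in L² equal to x f exists exactly when f is in the
domain, and T g then witnesses that T f is in it too. -/
theorem commutesWith_position_iff (T : HOne →L[ℂ] HOne) :
    CommutesWith position T ↔ CommutesWithMul T (fun x => (x : ℂ)) := by
  constructor
  · intro h f g hg
    have hf : f ∈ position.domain := (memLp_congr_ae hg).1 (Lp.memLp g)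
    obtain ⟨h1, h2⟩ := h ⟨f, hf⟩
    have hg' : position ⟨f, hf⟩ = g := Lp.ext ((MemLp.coeFn_toLp hf).trans hg.symm)
    rw [hg'] at h2
    rw [← h2]
    exact MemLp.coeFn_toLp h1
  · intro h f
    have h1 := h f (position f) (MemLp.coeFn_toLp f.2)
    have h2 : T (f : HOne) ∈ position.domain := (memLp_congr_ae h1).1 (Lp.memLp _)
    exact ⟨h2, Lp.ext ((MemLp.coeFn_toLp h2).trans h1.symm)⟩

namespace CommutesWithMul

variable {T : HOne →L[ℂ] HOne} {h h₁ h₂ : ℝ → ℂ}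

theorem inv (H : CommutesWithMul T h) (h0 : ∀ x, h x ≠ 0) :
    CommutesWithMul T (fun x => (h x)⁻¹) := by
  intro f g hg
  have := H g f (by filter_upwards [hg] with x hx; rw [hx, mul_inv_cancel_left₀ (h0 x)])
  filter_upwards [this] with x hx
  rw [hx, inv_mul_cancel_left₀ (h0 x)]

theorem const (T : HOne →L[ℂ] HOne) (c : ℂ) : CommutesWithMul T (fun _ => c) := by
  intro f g hg
  have : g = c • f := Lp.ext (hg.trans (Lp.coeFn_smul c f).symm)
  rw [this, map_smul]
  exact Lp.coeFn_smul c (T f)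

/-- Here h may be unbounded. Since b ≠ 0, h f = b⁻¹ (g - c f) is automatically in L², so the
hypothesis on h applies to it. -/
theorem affine (H : CommutesWithMul T h) (c : ℂ) {b : ℂ} (hb : b ≠ 0) :
    CommutesWithMul T (fun x => c + b * h x) := by
  intro f g hg
  have := H f (b⁻¹ • (g - c • f)) (by
    filter_upwards [hg, Lp.coeFn_smul b⁻¹ (g - c • f), Lp.coeFn_sub g (c • f),
      Lp.coeFn_smul c f] with x h1 h2 h3 h4
    rw [h2, Pi.smul_apply, h3, Pi.sub_apply, h4, Pi.smul_apply, h1]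
    simp only [smul_eq_mul]
    field_simp
    ring)
  rw [map_smul, map_sub, map_smul] at this
  filter_upwards [this, Lp.coeFn_smul b⁻¹ (T g - c • T f), Lp.coeFn_sub (T g) (c • T f),
      Lp.coeFn_smul c (T f)] with x h1 h2 h3 h4
  rw [h2, Pi.smul_apply, h3, Pi.sub_apply, h4, Pi.smul_apply] at h1
  simp only [smul_eq_mul] at h1
  rw [add_mul, mul_assoc b, ← h1, mul_inv_cancel_left₀ hb]
  ring

theorem mul (H₁ : CommutesWithMul T h₁) (H₂ : CommutesWithMul T h₂) (hm : Measurable h₂)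
    {C : ℝ} (hC : ∀ x, ‖h₂ x‖ ≤ C) : CommutesWithMul T (fun x => h₁ x * h₂ x) := by
  intro f g hg
  obtain ⟨k, hk⟩ := exists_coeFn_eq_mul hm hC f
  have h1 := H₂ f k hk
  have h2 := H₁ k g (by filter_upwards [hg, hk] with x hx hx'; rw [hx, hx', mul_assoc])
  filter_upwards [h1, h2] with x h1 h2
  rw [h2, h1, mul_assoc]

theorem add (H₁ : CommutesWithMul T h₁) (H₂ : CommutesWithMul T h₂) (hm : Measurable h₂)
    {C : ℝ} (hC : ∀ x, ‖h₂ x‖ ≤ C) : CommutesWithMul T (fun x => h₁ x + h₂ x) := by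
  intro f g hg
  obtain ⟨k, hk⟩ := exists_coeFn_eq_mul hm hC f
  have h1 := H₂ f k hk
  have h2 := H₁ f (g - k) (by
    filter_upwards [hg, hk, Lp.coeFn_sub g k] with x hx hx' hs
    rw [hs, Pi.sub_apply, hx, hx']; ring)
  rw [map_sub] at h2
  filter_upwards [h1, h2, Lp.coeFn_sub (T g) (T k)] with x h1 h2 h3
  rw [h3, Pi.sub_apply, h1] at h2
  linear_combination h2

theorem pow (H : CommutesWithMul T h) (hm : Measurable h)
    {C : ℝ} (hC : ∀ x, ‖h x‖ ≤ C) (n : ℕ) : CommutesWithMul T (fun x => h x ^ n) := by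
  induction n with
  | zero => simpa using const T 1
  | succ n ih => simpa [pow_succ] using ih.mul H hm hC

end CommutesWithMul

theorem norm_sq_eq_integral (f : HOne) : ‖f‖ ^ 2 = ∫ x, ‖f x‖ ^ 2 := by
  have h := inner_self_eq_norm_sq_to_K (𝕜 := ℂ) f
  rw [L2.inner_def] at h
  have h2 : ∫ x, inner ℂ (f x) (f x) = ((∫ x, ‖f x‖ ^ 2 : ℝ) : ℂ) := by
    rw [← integral_complex_ofReal]
    congr 1 with x
    rw [inner_self_eq_norm_sq_to_K]
    simp
  rw [h2] at h
  exact Complex.ofReal_injective (by push_cast; exact h.symm)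

theorem tendsto_of_coeFn_eq_mul {h : ℕ → ℝ → ℂ} {h₀ : ℝ → ℂ} {C : ℝ}
    (hC : ∀ n x, ‖h n x‖ ≤ C) (hlim : ∀ x, Tendsto (fun n => h n x) atTop (𝓝 (h₀ x)))
    {f : HOne} {g : ℕ → HOne} {g₀ : HOne}
    (hg : ∀ n, (g n : ℝ → ℂ) =ᵐ[volume] fun x => h n x * f x)
    (hg₀ : (g₀ : ℝ → ℂ) =ᵐ[volume] fun x => h₀ x * f x) : Tendsto g atTop (𝓝 g₀) := by
  rw [tendsto_iff_norm_sub_tendsto_zero]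
  have hC₀ : ∀ x, ‖h₀ x‖ ≤ C := fun x =>
    le_of_tendsto (hlim x).norm (Eventually.of_forall fun n => hC n x)
  have key : Tendsto (fun n => ‖g n - g₀‖ ^ 2) atTop (𝓝 0) := by
    simp_rw [norm_sq_eq_integral]
    have hae : ∀ n, ((g n - g₀ : HOne) : ℝ → ℂ) =ᵐ[volume] fun x => (h n x - h₀ x) * f x := by
      intro n
      filter_upwards [hg n, hg₀, Lp.coeFn_sub (g n) g₀] with x h1 h2 h3
      rw [h3, Pi.sub_apply, h1, h2, sub_mul]
    have h0 : (0 : ℝ) = ∫ x : ℝ, (0 : ℝ) := by simp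
    rw [h0]
    refine tendsto_integral_of_dominated_convergence (fun x => (C + C) ^ 2 * ‖f x‖ ^ 2)
      (fun n => ((Lp.aestronglyMeasurable _).norm.pow 2)) ?_ ?_ ?_
    · exact ((memLp_two_iff_integrable_sq_norm (Lp.memLp f).1).1 (Lp.memLp f)).const_mul _
    · intro n
      filter_upwards [hae n] with x hx
      rw [hx, norm_mul, mul_pow, Real.norm_of_nonneg (by positivity)]
      gcongr
      exact (norm_sub_le _ _).trans (add_le_add (hC n x) (hC₀ x))
    · have := ae_all_iff.2 hae
      filter_upwards [this] with x hx
      simp_rw [hx]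
      have := (((hlim x).sub_const (h₀ x)).mul_const (f x)).norm.pow 2
      simpa using this
  have := (Real.continuous_sqrt.tendsto 0).comp key
  simpa [Function.comp_def, Real.sqrt_sq (norm_nonneg _)] using this

namespace CommutesWithMul

variable {T : HOne →L[ℂ] HOne}

/-- By dominated convergence h_n f → h₀ f and h_n T f → h₀ T f in L²; continuity of T identifies the
limits. -/
theorem of_tendsto {h : ℕ → ℝ → ℂ} {h₀ : ℝ → ℂ} {C : ℝ} (hm : ∀ n, Measurable (h n))
    (hC : ∀ n x, ‖h n x‖ ≤ C) (hlim : ∀ x, Tendsto (fun n => h n x) atTop (𝓝 (h₀ x)))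
    (H : ∀ n, CommutesWithMul T (h n)) : CommutesWithMul T h₀ := by
  intro f g hg
  have hC₀ : ∀ x, ‖h₀ x‖ ≤ C := fun x =>
    le_of_tendsto (hlim x).norm (Eventually.of_forall fun n => hC n x)
  have hm₀ : Measurable h₀ := measurable_of_tendsto_metrizable hm (tendsto_pi_nhds.2 hlim)
  choose k hk using fun n => exists_coeFn_eq_mul (hm n) (hC n) f
  obtain ⟨l, hl⟩ := exists_coeFn_eq_mul hm₀ hC₀ (T f)
  have h1 := (T.continuous.tendsto g).comp (tendsto_of_coeFn_eq_mul hC hlim hk hg)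
  have h2 := tendsto_of_coeFn_eq_mul (g := fun n => T (k n)) hC hlim (fun n => H n f (k n) (hk n)) hl
  rw [tendsto_nhds_unique h1 h2]
  exact hl

theorem one_add_mul_ne_zero (s x : ℝ) : (1 : ℂ) + (s * Complex.I) * x ≠ 0 := by
  intro h
  have := congrArg Complex.re h
  simp at this

theorem norm_inv_one_add_le (s x : ℝ) : ‖((1 : ℂ) + (s * Complex.I) * x)⁻¹‖ ≤ 1 := by
  rw [norm_inv]
  refine inv_le_one_of_one_le₀ ?_
  have := Complex.abs_re_le_norm ((1 : ℂ) + (s * Complex.I) * x)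
  simpa using this

/-- An operator commuting with the position operator commutes with its unitary group. -/
theorem exp_of_position (H : CommutesWithMul T (fun x => (x : ℂ))) (t : ℝ) :
    CommutesWithMul T (fun x => Complex.exp (-(Complex.I * (x : ℂ) * (t : ℂ)))) := by
  -- The resolvents below are obtained by inverting an affine function of x with nonzero slope,
  -- which excludes t = 0.
  rcases eq_or_ne t 0 with rfl | ht
  · simpa using const T 1
  have hm : ∀ n : ℕ, Measurable fun x : ℝ =>
      ((1 : ℂ) + (((t / (n + 1) : ℝ) : ℂ) * Complex.I) * x)⁻¹ := fun n => by fun_prop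
  -- The functions (1 + itx/(n+1))^{-(n+1)} are bounded by 1 and tend to e^{-itx}; the index n + 1
  -- avoids division by zero.
  refine of_tendsto
    (h := fun n x => (((1 : ℂ) + (((t / (n + 1) : ℝ) : ℂ) * Complex.I) * x)⁻¹) ^ (n + 1))
    (C := 1) (fun n => (hm n).pow_const _) ?_ ?_ ?_
  · intro n x
    rw [norm_pow]
    exact pow_le_one₀ (norm_nonneg _) (norm_inv_one_add_le _ _)
  · intro x
    have h1 := (tendsto_add_atTop_iff_nat 1).2
      (Complex.tendsto_one_add_div_pow_exp (Complex.I * (x : ℂ) * (t : ℂ)))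
    have h2 := h1.inv₀ (Complex.exp_ne_zero _)
    rw [Complex.exp_neg]
    refine h2.congr fun n => ?_
    rw [inv_pow]
    congr 3
    push_cast
    ring
  · intro n
    have hne : (((t / (n + 1) : ℝ) : ℂ) * Complex.I) ≠ 0 := by
      refine mul_ne_zero (Complex.ofReal_ne_zero.2 (div_ne_zero ht ?_)) Complex.I_ne_zero
      positivity
    exact ((H.affine 1 hne).inv (one_add_mul_ne_zero _)).pow (hm n) (norm_inv_one_add_le _) _

theorem norm_indicator_one_le (s : Set ℝ) (x : ℝ) : ‖s.indicator (1 : ℝ → ℂ) x‖ ≤ 1 := by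
  by_cases hx : x ∈ s <;> simp [hx]

theorem union {s t : Set ℝ} (hs : CommutesWithMul T (s.indicator 1))
    (ht : CommutesWithMul T (t.indicator 1)) (hd : Disjoint s t) (htm : MeasurableSet t) :
    CommutesWithMul T ((s ∪ t).indicator 1) := by
  rw [Set.indicator_union_of_disjoint hd]
  exact hs.add ht (measurable_one.indicator htm) (norm_indicator_one_le t)

/-- Closed half-lines are a π-system generating the Borel sets. Countable disjoint unions are
pointwise bounded limits of finite ones. -/
theorem indicator_of_Ici (H : ∀ c : ℝ, CommutesWithMul T ((Set.Ici c).indicator 1))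
    {s : Set ℝ} (hs : MeasurableSet s) : CommutesWithMul T (s.indicator 1) := by
  induction s, hs using MeasurableSpace.induction_on_inter
    (borel_eq_generateFrom_Ici ℝ ▸ BorelSpace.measurable_eq) isPiSystem_Ici with
  | empty => simpa using! const T 0
  | basic t ht =>
    obtain ⟨c, rfl⟩ := ht
    exact H c
  | compl t htm iht =>
    convert iht.affine 1 (b := -1) (by simp) using 1
    ext x
    by_cases hx : x ∈ t <;> simp [hx]
  | iUnion f hd hf ih =>
    refine of_tendsto (h := fun n => (⋃ i ∈ Finset.range n, f i).indicator 1) (C := 1)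
      (fun n => measurable_one.indicator (Finset.measurableSet_biUnion _ fun i _ => hf i))
      (fun n x => norm_indicator_one_le _ x) ?_ ?_
    · intro x
      exact ((tendsto_indicator_biUnion_finset f 1 x).comp tendsto_finset_range).mono_right
        (pure_le_nhds _)
    · intro n
      induction n with
      | zero => simpa using! const T 0
      | succ n ihn =>
        have : (⋃ i ∈ Finset.range (n + 1), f i) = (⋃ i ∈ Finset.range n, f i) ∪ f n := by
          rw [Finset.range_add_one, Finset.set_biUnion_insert, Set.union_comm]
        simp only [this]
        refine ihn.union (ih n) ?_ (hf n)
        simp only [Set.disjoint_iUnion_left, Finset.mem_range]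
        exact fun i hi => hd hi.ne

theorem simpleFunc (H : ∀ s : Set ℝ, MeasurableSet s → CommutesWithMul T (s.indicator 1))
    (h : SimpleFunc ℝ ℂ) : CommutesWithMul T h := by
  induction h using SimpleFunc.induction with
  | const c hs =>
    convert (const T c).mul (H _ hs) (measurable_one.indicator hs) (norm_indicator_one_le _) using 1
    ext x
    simp only [SimpleFunc.coe_piecewise, SimpleFunc.coe_const, Set.piecewise, Set.indicator,
      Function.const_apply, Pi.one_apply, mul_ite, mul_one, mul_zero]
  | add hd h1 h2 =>
    rename_i f g
    obtain ⟨C, hC⟩ := g.exists_forall_norm_le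
    exact h1.add h2 g.measurable hC

theorem of_indicator (H : ∀ s : Set ℝ, MeasurableSet s → CommutesWithMul T (s.indicator 1))
    {h : ℝ → ℂ} (hm : Measurable h) {C : ℝ} (hC : ∀ x, ‖h x‖ ≤ C) : CommutesWithMul T h :=
  of_tendsto (h := fun n => hm.stronglyMeasurable.approxBounded C n) (C := C)
    (fun _ => SimpleFunc.measurable _)
    (fun n x => StronglyMeasurable.norm_approxBounded_le _ ((norm_nonneg _).trans (hC 0)) n x)
    (fun x => StronglyMeasurable.tendsto_approxBounded_of_norm_le _ (hC x))
    (fun _ => simpleFunc H _)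

/-- The bounded function (1 + ix)⁻¹ is reached from indicators; x = i - i (1 + ix) is then recovered
by inversion and an affine change. -/
theorem position_of_Ici (H : ∀ c : ℝ, CommutesWithMul T ((Set.Ici c).indicator 1)) :
    CommutesWithMul T (fun x => (x : ℂ)) := by
  have hm : Measurable fun x : ℝ => ((1 : ℂ) + (((1 : ℝ) : ℂ) * Complex.I) * x)⁻¹ := by fun_prop
  have h1 := of_indicator (fun s hs => indicator_of_Ici H hs) hm (norm_inv_one_add_le 1)
  have h2 := (h1.inv fun x => inv_ne_zero (one_add_mul_ne_zero 1 x)).affine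
    (Complex.I) (b := -Complex.I) (by simp)
  convert h2 using 2 with x
  rw [inv_inv]
  push_cast
  linear_combination (x : ℂ) * Complex.I_mul_I

theorem Ici_of_Ico {L : ℝ} (hL : 0 < L)
    (H : ∀ c : ℝ, CommutesWithMul T ((Set.Ico c (c + L)).indicator 1)) (c : ℝ) :
    CommutesWithMul T ((Set.Ici c).indicator 1) := by
  refine of_tendsto (h := fun n : ℕ => (Set.Ico c (c + n * L)).indicator 1) (C := 1)
    (fun n => measurable_one.indicator measurableSet_Ico) (fun n x => norm_indicator_one_le _ x) ?_ ?_
  · intro x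
    obtain ⟨N, hN⟩ := exists_nat_gt ((x - c) / L)
    refine tendsto_const_nhds.congr' ?_
    filter_upwards [eventually_ge_atTop N] with n hn
    have : x < c + n * L := by
      have h1 : (N : ℝ) ≤ n := by exact_mod_cast hn
      have := (div_lt_iff₀ hL).1 (hN.trans_le h1)
      linarith
    simp [Set.indicator_apply, this]
  · intro n
    induction n with
    | zero => simpa using! const T 0
    | succ n ih =>
      have h0 : (0 : ℝ) ≤ n * L := by positivity
      have : Set.Ico c (c + (n + 1 : ℕ) * L) =
          Set.Ico c (c + n * L) ∪ Set.Ico (c + n * L) (c + n * L + L) := by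
        rw [Set.Ico_union_Ico_eq_Ico (by linarith) (by linarith)]
        congr 1
        push_cast
        ring
      rw [this]
      exact ih.union (H _) (Set.Ico_disjoint_Ico_same) measurableSet_Ico

end CommutesWithMul

/-! ### Operators that preserve blocks of length L -/

theorem ae_eq_zero_of_inner_eq_zero {s : Set ℝ} (hs : MeasurableSet s) {ψ : HOne}
    (h : ∀ φ : HOne, (∀ᵐ x, x ∉ s → φ x = 0) → inner ℂ φ ψ = 0) : ∀ᵐ x, x ∈ s → ψ x = 0 := by
  obtain ⟨φ, hφ⟩ := exists_coeFn_eq_mul (measurable_one.indicator hs)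
    (CommutesWithMul.norm_indicator_one_le s) ψ
  have h1 := h φ (by filter_upwards [hφ] with x hx hxs; simp [hx, hxs])
  have h2 : inner ℂ φ φ = inner ℂ φ ψ := by
    rw [L2.inner_def, L2.inner_def]
    refine integral_congr_ae ?_
    filter_upwards [hφ] with x hx
    by_cases hxs : x ∈ s <;> simp [hx, hxs]
  have h3 : φ = 0 := inner_self_eq_zero.1 (h2.trans h1)
  rw [h3] at hφ
  filter_upwards [hφ, Lp.coeFn_zero ℂ 2 (volume : Measure ℝ)] with x hx h0 hxs
  rw [h0] at hx
  simpa [hxs] using hx.symm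

/-- The translates of one block by multiples of L tile the line, so vanishing on all the others
leaves only the block with m = 0. -/
theorem ae_eq_zero_of_translates {L : ℝ} (hL : 0 < L) (c : ℝ) {ψ : HOne}
    (h : ∀ m : ℤ, m ≠ 0 → ∀ φ : HOne,
      (∀ᵐ x, x ∉ Set.Ico (c + m * L) (c + m * L + L) → φ x = 0) → inner ℂ φ ψ = 0) :
    ∀ᵐ x, x ∉ Set.Ico c (c + L) → ψ x = 0 := by
  have h1 : ∀ᵐ x, ∀ m : ℤ, m ≠ 0 → x ∈ Set.Ico (c + m * L) (c + m * L + L) → ψ x = 0 := by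
    rw [ae_all_iff]
    intro m
    rcases eq_or_ne m 0 with rfl | hm
    · simp
    filter_upwards [ae_eq_zero_of_inner_eq_zero measurableSet_Ico (h m hm)] with x hx _ using hx
  filter_upwards [h1] with x hx hxc
  have e1 : (⌊(x - c) / L⌋ : ℝ) * L ≤ x - c := (le_div_iff₀ hL).1 (Int.floor_le _)
  have e2 : x - c < (⌊(x - c) / L⌋ + 1 : ℝ) * L := (div_lt_iff₀ hL).1 (Int.lt_floor_add_one _)
  have hmem : x ∈ Set.Ico (c + ⌊(x - c) / L⌋ * L) (c + ⌊(x - c) / L⌋ * L + L) :=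
    ⟨by linarith, by linarith⟩
  refine hx ⌊(x - c) / L⌋ (fun h0 => hxc ?_) hmem
  simpa [h0] using hmem

/-- A bounded operator without matrix elements between distinct translates by multiples of `L` of
any interval of length `L` commutes with the position operator. -/
theorem CommutesWithMul.position_of_blocks {T : HOne →L[ℂ] HOne} {L : ℝ} (hL : 0 < L)
    (H : ∀ (c : ℝ) (m : ℤ), m ≠ 0 → ∀ φ f : HOne, (∀ᵐ x, x ∉ Set.Ico c (c + L) → φ x = 0) →
      (∀ᵐ x, x ∉ Set.Ico (c + m * L) (c + m * L + L) → f x = 0) → inner ℂ φ (T f) = 0) :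
    CommutesWithMul T (fun x => (x : ℂ)) := by
  refine position_of_Ici (Ici_of_Ico hL fun c => ?_)
  intro f g hg
  have hsupp : ∀ᵐ x, x ∉ Set.Ico c (c + L) → g x = 0 := by
    filter_upwards [hg] with x hx hxs
    simp [hx, hxs]
  have hTg : ∀ᵐ x, x ∉ Set.Ico c (c + L) → T g x = 0 := by
    refine ae_eq_zero_of_translates hL c fun m hm φ hφ => ?_
    -- Seen from the block at c + mL, the block at c is the translate with index -m.
    refine H (c + m * L) (-m) (neg_ne_zero.2 hm) φ g hφ ?_
    convert hsupp using 4
    push_cast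
    ring_nf
  have hTf : ∀ᵐ x, x ∈ Set.Ico c (c + L) → T (f - g) x = 0 := by
    refine ae_eq_zero_of_inner_eq_zero measurableSet_Ico fun φ hφ => ?_
    -- T†φ stays in the block of φ, where f - g vanishes.
    have h1 := ae_eq_zero_of_translates (ψ := ContinuousLinearMap.adjoint T φ) hL c
      fun m hm k hk => by
        rw [ContinuousLinearMap.adjoint_inner_right, ← inner_conj_symm, H c m hm φ k hφ hk, map_zero]
    rw [← ContinuousLinearMap.adjoint_inner_left, L2.inner_def]
    refine integral_eq_zero_of_ae ?_
    filter_upwards [h1, hg, Lp.coeFn_sub f g] with x h1 hx hs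
    by_cases hxs : x ∈ Set.Ico c (c + L)
    · rw [hs, Pi.sub_apply, hx]
      simp [hxs]
    · simp [h1 hxs]
  rw [map_sub] at hTf
  filter_upwards [hTg, hTf, Lp.coeFn_sub (T f) (T g)] with x h1 h2 h3
  by_cases hxs : x ∈ Set.Ico c (c + L)
  · have := h2 hxs
    rw [h3, Pi.sub_apply, sub_eq_zero] at this
    simp [hxs, this]
  · simp [hxs, h1 hxs]

/-! ### Translations, their weak limit at infinity, and intertwiners -/

/-- The translation `(translate t f) y = f (y + t)` on `L²(ℝ)`. -/
noncomputable def translate (t : ℝ) : HOne →ₗᵢ[ℂ] HOne :=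
  Lp.compMeasurePreservingₗᵢ ℂ (fun y : ℝ => y + t) (measurePreserving_add_right volume t)

theorem coeFn_translate (t : ℝ) (f : HOne) :
    (translate t f : ℝ → ℂ) =ᵐ[volume] fun y => f (y + t) :=
  Lp.coeFn_compMeasurePreserving f (measurePreserving_add_right volume t)

theorem translate_translate (s t : ℝ) (f : HOne) :
    translate s (translate t f) = translate (s + t) f := by
  refine Lp.ext ?_
  filter_upwards [coeFn_translate s (translate t f), coeFn_translate (s + t) f,
    (measurePreserving_add_right volume s).quasiMeasurePreserving.ae (coeFn_translate t f)]
    with y h1 h2 h3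
  rw [h1, h2, h3, add_assoc]

theorem translate_zero (f : HOne) : translate 0 f = f := by
  refine Lp.ext ?_
  filter_upwards [coeFn_translate 0 f] with y h
  rw [h, add_zero]

theorem continuous_translate (f : HOne) : Continuous fun t => translate t f := by
  have hg : Continuous fun t : ℝ => (⟨fun y => y + t, by fun_prop⟩ : C(ℝ, ℝ)) :=
    ContinuousMap.continuous_of_continuous_uncurry _ (by
      simp only [Function.uncurry_def, ContinuousMap.coe_mk]; fun_prop)
  exact Continuous.compMeasurePreservingLp (f := fun _ : ℝ => f) continuous_const hg
    (fun t => measurePreserving_add_right volume t) (by simp)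

theorem inner_translate_eq_zero {u w : HOne} {R : ℝ} (hu : ∀ᵐ x, R < |x| → u x = 0)
    (hw : ∀ᵐ x, R < |x| → w x = 0) {s : ℝ} (hs : 2 * R < |s|) :
    inner ℂ u (translate s w) = 0 := by
  rw [L2.inner_def]
  refine integral_eq_zero_of_ae ?_
  filter_upwards [hu, coeFn_translate s w,
    (measurePreserving_add_right volume s).quasiMeasurePreserving.ae hw] with x h1 h2 h3
  by_cases hx : R < |x|
  · simp [h1 hx]
  · have : R < |x + s| := by
      have h4 : |s| ≤ |x + s| + |x| := by
        calc |s| = |(x + s) - x| := by ring_nf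
          _ ≤ _ := abs_sub _ _
      linarith
    simp [h2, h3 this]

theorem exists_norm_sub_le_ae_eq_zero (u : HOne) {δ : ℝ} (hδ : 0 < δ) :
    ∃ (v : HOne) (R : ℝ), ‖u - v‖ ≤ δ ∧ ∀ᵐ x, R < |x| → v x = 0 := by
  obtain ⟨g, hg, hle, -, hmem⟩ := (Lp.memLp u).exists_hasCompactSupport_eLpNorm_sub_le
    (by simp) (ε := ENNReal.ofReal δ) (by simpa using hδ)
  obtain ⟨R, hR⟩ := hg.isCompact.isBounded.exists_norm_le
  refine ⟨hmem.toLp g, R, ?_, ?_⟩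
  · rw [Lp.norm_def]
    refine ENNReal.toReal_le_of_le_ofReal hδ.le (le_of_eq_of_le (eLpNorm_congr_ae ?_) hle)
    filter_upwards [Lp.coeFn_sub u (hmem.toLp g), hmem.coeFn_toLp] with x h1 h2
    rw [h1, Pi.sub_apply, h2, Pi.sub_apply]
  · filter_upwards [hmem.coeFn_toLp] with x hx hRx
    rw [hx]
    by_contra h
    exact absurd (hR x (subset_tsupport g h)) (not_le.2 hRx)

/-- Translations tend weakly to zero at infinity. -/
theorem tendsto_inner_translate (u w : HOne) :
    Tendsto (fun s => inner ℂ u (translate s w)) (cocompact ℝ) (𝓝 0) := by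
  rw [Metric.tendsto_nhds]
  intro ε hε
  -- The final error is at most δ (‖w‖ + ‖u‖ + 1); the cap at 1 serves to bound ‖u'‖ by ‖u‖ + 1.
  set δ : ℝ := min 1 (ε / (2 * (‖w‖ + ‖u‖ + 2))) with hδdef
  have hδ : 0 < δ := by positivity
  obtain ⟨u', R, hu, hu'⟩ := exists_norm_sub_le_ae_eq_zero u hδ
  obtain ⟨w', R', hw, hw'⟩ := exists_norm_sub_le_ae_eq_zero w hδ
  have hev : ∀ᶠ s : ℝ in cocompact ℝ, 2 * max R R' < ‖s‖ :=
    tendsto_norm_cocompact_atTop.eventually (eventually_gt_atTop _)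
  filter_upwards [hev] with s hs
  have h0 : inner ℂ u' (translate s w') = 0 := by
    refine inner_translate_eq_zero (R := max R R') ?_ ?_ hs
    · filter_upwards [hu'] with x hx hR using hx ((le_max_left _ _).trans_lt hR)
    · filter_upwards [hw'] with x hx hR using hx ((le_max_right _ _).trans_lt hR)
  have h1 : inner ℂ u (translate s w) =
      inner ℂ (u - u') (translate s w) + inner ℂ u' (translate s (w - w')) := by
    rw [map_sub, inner_sub_left, inner_sub_right, h0]
    ring
  have hu1 : ‖u'‖ ≤ ‖u‖ + 1 := by
    have := norm_sub_norm_le u' u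
    rw [norm_sub_rev] at this
    have := min_le_left 1 (ε / (2 * (‖w‖ + ‖u‖ + 2)))
    linarith
  rw [dist_zero_right, h1]
  calc _ ≤ ‖inner ℂ (u - u') (translate s w)‖ + ‖inner ℂ u' (translate s (w - w'))‖ :=
        norm_add_le _ _
    _ ≤ ‖u - u'‖ * ‖translate s w‖ + ‖u'‖ * ‖translate s (w - w')‖ :=
        add_le_add (norm_inner_le_norm _ _) (norm_inner_le_norm _ _)
    _ ≤ δ * ‖w‖ + (‖u‖ + 1) * δ := by
        rw [LinearIsometry.norm_map, LinearIsometry.norm_map]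
        gcongr
    _ ≤ (ε / (2 * (‖w‖ + ‖u‖ + 2))) * (‖w‖ + ‖u‖ + 2) := by
        have := min_le_right 1 (ε / (2 * (‖w‖ + ‖u‖ + 2)))
        rw [← hδdef] at this
        calc _ = δ * (‖w‖ + ‖u‖ + 1) := by ring
          _ ≤ _ := by gcongr; linarith
    _ = ε / 2 := by field_simp
    _ < ε := by linarith

/-- Translations are isometries, so a finite cover of K makes the weak convergence uniform on K. -/
theorem tendsto_inner_translate_of_isCompact (u : HOne) {K : Set HOne} (hK : IsCompact K)
    {s : ℕ → ℝ} (hs : Tendsto s atTop (cocompact ℝ)) {w : ℕ → HOne} (hw : ∀ N, w N ∈ K) :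
    Tendsto (fun N => inner ℂ u (translate (s N) (w N))) atTop (𝓝 0) := by
  rw [Metric.tendsto_nhds]
  intro ε hε
  have hδ : 0 < ε / (2 * (‖u‖ + 1)) := by positivity
  obtain ⟨t, -, ht, hcov⟩ := hK.finite_cover_balls hδ
  have h1 : ∀ᶠ N in atTop, ∀ x ∈ t, dist (inner ℂ u (translate (s N) x)) 0 < ε / 2 :=
    (eventually_all_finite ht).2 fun x _ =>
      Metric.tendsto_nhds.1 ((tendsto_inner_translate u x).comp hs) _ (half_pos hε)
  filter_upwards [h1] with N hN
  obtain ⟨x, hx, hxw⟩ := Set.mem_iUnion₂.1 (hcov (hw N))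
  have h2 := hN x hx
  rw [dist_zero_right] at h2 ⊢
  rw [Metric.mem_ball, dist_eq_norm] at hxw
  have h3 : inner ℂ u (translate (s N) (w N)) =
      inner ℂ u (translate (s N) x) + inner ℂ u (translate (s N) (w N - x)) := by
    rw [map_sub, inner_sub_right]
    ring
  rw [h3]
  calc _ ≤ ‖inner ℂ u (translate (s N) x)‖ + ‖inner ℂ u (translate (s N) (w N - x))‖ :=
        norm_add_le _ _
    _ ≤ ‖inner ℂ u (translate (s N) x)‖ + ‖u‖ * ‖w N - x‖ := by
        gcongr
        exact (norm_inner_le_norm _ _).trans (by rw [LinearIsometry.norm_map])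
    _ ≤ ‖inner ℂ u (translate (s N) x)‖ + (‖u‖ + 1) * (ε / (2 * (‖u‖ + 1))) := by
        gcongr
        linarith
    _ = ‖inner ℂ u (translate (s N) x)‖ + ε / 2 := by field_simp
    _ < ε := by linarith

/-- `B` intertwines the translation by `b` with the translation by `a`. -/
def Intertwines (a b : ℝ) (B : HOne →L[ℂ] HOne) : Prop :=
  ∀ v, translate a (B v) = B (translate b v)

theorem Intertwines.nat_mul {a b : ℝ} {B : HOne →L[ℂ] HOne} (h : Intertwines a b B) (n : ℕ) :
    Intertwines (n * a) (n * b) B := by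
  induction n with
  | zero => intro v; simp [translate_zero]
  | succ n ih =>
    intro v
    have e : ∀ c : ℝ, ((n + 1 : ℕ) : ℝ) * c = n * c + c := fun c => by push_cast; ring
    rw [e, e, ← translate_translate, ← translate_translate, h, ih]

theorem Intertwines.neg {a b : ℝ} {B : HOne →L[ℂ] HOne} (h : Intertwines a b B) :
    Intertwines (-a) (-b) B := by
  intro v
  have h1 := h (translate (-b) v)
  rw [translate_translate, add_neg_cancel, translate_zero] at h1
  rw [← h1, translate_translate, neg_add_cancel, translate_zero]

theorem Intertwines.int_mul {a b : ℝ} {B : HOne →L[ℂ] HOne} (h : Intertwines a b B) (m : ℤ) :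
    Intertwines (m * a) (m * b) B := by
  obtain ⟨n, rfl | rfl⟩ := m.eq_nat_or_neg
  · exact_mod_cast h.nat_mul n
  · convert (h.nat_mul n).neg using 1 <;> push_cast <;> ring

/-- Split N b into an integer multiple of b' and a remainder r. The multiple passes through B,
leaving a net translation s that grows linearly in N because a b' ≠ a' b, applied to B T_{-r} v,
which stays in a compact set because r is bounded. -/
theorem Intertwines.tendsto_inner {a b a' b' : ℝ} {B : HOne →L[ℂ] HOne}
    (h : Intertwines a' b' B) (hb' : b' ≠ 0) (hdet : a * b' ≠ a' * b) (u v : HOne) :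
    Tendsto (fun N : ℕ => inner ℂ u (translate (N * a) (B (translate (-(N * b)) v)))) atTop
      (𝓝 0) := by
  set r : ℕ → ℝ := fun N => Int.fract (N * b / b') * b' with hr
  set s : ℕ → ℝ := fun N => N * ((a * b' - a' * b) / b') + Int.fract (N * b / b') * a' with hs
  have hfr : ∀ N : ℕ, (N * b / b' : ℝ) = ⌊(N * b / b' : ℝ)⌋ + Int.fract (N * b / b' : ℝ) :=
    fun N => (Int.floor_add_fract _).symm
  have key : ∀ N : ℕ, translate (N * a) (B (translate (-(N * b)) v)) =
      translate (s N) (B (translate (-r N) v)) := by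
    intro N
    have e1 : -(N * b) = ((-⌊(N * b / b' : ℝ)⌋ : ℤ) : ℝ) * b' + -r N := by
      have := (div_eq_iff hb').1 (hfr N)
      rw [hr]
      push_cast
      linear_combination -this
    have e2 : N * a + ((-⌊(N * b / b' : ℝ)⌋ : ℤ) : ℝ) * a' = s N := by
      have : ((⌊(N * b / b' : ℝ)⌋ : ℤ) : ℝ) = N * b / b' - Int.fract (N * b / b' : ℝ) := by
        rw [← Int.self_sub_floor]; ring
      rw [hs]
      push_cast
      rw [this]
      field_simp
      ring
    rw [e1, ← translate_translate, ← h.int_mul, translate_translate, e2]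
  simp_rw [key]
  have hK : IsCompact ((fun q : ℝ => B (translate (-(q * b')) v)) '' Set.Icc 0 1) := by
    refine isCompact_Icc.image ?_
    exact B.continuous.comp ((continuous_translate v).comp (by fun_prop))
  refine tendsto_inner_translate_of_isCompact u hK ?_ fun N =>
    ⟨Int.fract (N * b / b'), ⟨Int.fract_nonneg _, (Int.fract_lt_one _).le⟩, rfl⟩
  rw [← Metric.cobounded_eq_cocompact, ← tendsto_norm_atTop_iff_cobounded]
  have hd : 0 < |(a * b' - a' * b) / b'| := abs_pos.2 (div_ne_zero (sub_ne_zero.2 hdet) hb')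
  have h1 : Tendsto (fun N : ℕ => N * |(a * b' - a' * b) / b'| - |a'|) atTop atTop :=
    tendsto_atTop_add_const_right _ _ (tendsto_natCast_atTop_atTop.atTop_mul_const hd)
  refine tendsto_atTop_mono (fun N => ?_) h1
  have h2 : |Int.fract (N * b / b') * a'| ≤ |a'| := by
    rw [abs_mul, abs_of_nonneg (Int.fract_nonneg _)]
    exact mul_le_of_le_one_left (abs_nonneg _) (Int.fract_lt_one _).le
  have h3 : |N * ((a * b' - a' * b) / b')| = N * |(a * b' - a' * b) / b'| := by
    rw [abs_mul, Nat.abs_cast]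
  have h4 := abs_sub_abs_le_abs_sub (N * ((a * b' - a' * b) / b')) (-(Int.fract (N * b / b') * a'))
  rw [abs_neg, sub_neg_eq_add] at h4
  rw [Real.norm_eq_abs]
  simp only [hs]
  linarith

theorem Intertwines.translate_apply_translate {a b : ℝ} {B : HOne →L[ℂ] HOne} (h : Intertwines a b B)
    (N : ℕ) (v : HOne) : translate (N * a) (B (translate (-(N * b)) v)) = B v := by
  rw [h.nat_mul, translate_translate, add_neg_cancel, translate_zero]

/-- Nonzero operators intertwining translations with pairwise different ratios are linearly
independent. -/
theorem linearIndependent_of_intertwines {ι : Type*} {a b : ι → ℝ} {B : ι → HOne →L[ℂ] HOne}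
    (h : ∀ i, Intertwines (a i) (b i) (B i)) (hB : ∀ i, B i ≠ 0) (hb : ∀ i, b i ≠ 0)
    (hab : ∀ i j, i ≠ j → a i * b j ≠ a j * b i) : LinearIndependent ℂ B := by
  classical
  rw [linearIndependent_iff']
  intro s c hc i hi
  by_contra hci
  refine hB i ?_
  ext1 v
  refine ext_inner_left ℂ fun u => ?_
  -- Sandwiching the relation between T_{N a_i} and T_{-N b_i} fixes the i-th term and sends all the
  -- others weakly to zero.
  have h1 : ∀ N : ℕ, c i * inner ℂ u (B i v) + ∑ j ∈ s.erase i,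
      c j * inner ℂ u (translate (N * a i) (B j (translate (-(N * b i)) v))) = 0 := by
    intro N
    have h2 := congrArg (fun A : HOne →L[ℂ] HOne =>
      inner ℂ u (translate (N * a i) (A (translate (-(N * b i)) v)))) hc
    simp only [sum_apply, smul_apply, map_sum, map_smul,
      inner_sum, inner_smul_right, zero_apply, map_zero, inner_zero_right] at h2
    rw [← Finset.add_sum_erase _ _ hi, (h i).translate_apply_translate] at h2
    exact h2
  have h3 : Tendsto (fun N : ℕ => c i * inner ℂ u (B i v) + ∑ j ∈ s.erase i,
      c j * inner ℂ u (translate (N * a i) (B j (translate (-(N * b i)) v)))) atTop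
      (𝓝 (c i * inner ℂ u (B i v) + ∑ j ∈ s.erase i, c j * 0)) := by
    refine tendsto_const_nhds.add (tendsto_finsetSum _ fun j hj => ?_)
    exact ((h j).tendsto_inner (hb j) (hab i j (Finset.ne_of_mem_erase hj).symm) u v).const_mul _
  simp only [h1, mul_zero, Finset.sum_const_zero, add_zero] at h3
  have h4 := tendsto_nhds_unique h3 tendsto_const_nhds
  simpa [hci] using h4

/-! ### Uniqueness of Fourier coefficients -/

/-- An integrable function on an interval of length `L` whose Fourier coefficients vanish is zero
almost everywhere. -/
theorem ae_eq_zero_of_fourier_integral_eq_zero {L : ℝ} (hL : 0 < L) (c : ℝ) {F : ℝ → ℂ}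
    (hF : Integrable F) (hsupp : ∀ᵐ x, x ∉ Set.Ico c (c + L) → F x = 0)
    (h : ∀ j : ℤ, ∫ x : ℝ, fourier j (x : AddCircle L) * F x = 0) : F =ᵐ[volume] 0 := by
  have : Fact (0 < L) := ⟨hL⟩
  have hint : ∀ g : C(AddCircle L, ℂ), Integrable fun x : ℝ => g (x : AddCircle L) * F x := by
    intro g
    refine hF.bdd_mul (c := ‖g‖) ?_ (Eventually.of_forall fun x => g.norm_coe_le_norm _)
    exact (g.continuous.comp (AddCircle.continuous_mk' L)).aestronglyMeasurable
  let Φ : C(AddCircle L, ℂ) →ₗ[ℂ] ℂ :=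
    { toFun := fun g => ∫ x : ℝ, g (x : AddCircle L) * F x
      map_add' := fun g₁ g₂ => by
        simp only [ContinuousMap.add_apply, add_mul]
        exact integral_add (hint g₁) (hint g₂)
      map_smul' := fun a g => by
        simp only [ContinuousMap.smul_apply, smul_eq_mul, mul_assoc, RingHom.id_apply]
        exact integral_const_mul a _ }
  have hΦc : Continuous Φ := by
    refine AddMonoidHomClass.continuous_of_bound Φ (∫ x, ‖F x‖) fun g => ?_
    refine (norm_integral_le_integral_norm _).trans ?_
    rw [mul_comm, ← integral_const_mul]
    refine integral_mono (hint g).norm (hF.norm.const_mul _) fun x => ?_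
    simp only [norm_mul]
    gcongr
    exact g.norm_coe_le_norm _
  have hΦ : ∀ g, Φ g = 0 := by
    have h1 : (Submodule.span ℂ (Set.range (@fourier L))).topologicalClosure ≤ LinearMap.ker Φ := by
      refine Submodule.topologicalClosure_minimal _ (Submodule.span_le.2 ?_)
        (isClosed_singleton.preimage hΦc)
      rintro _ ⟨j, rfl⟩
      exact h j
    intro g
    rw [span_fourier_closure_eq_top] at h1
    exact h1 (Submodule.mem_top : g ∈ ⊤)
  have h2 : ∀ᵐ x, x ∈ Set.Ioo c (c + L) → F x = 0 := by
    refine isOpen_Ioo.ae_eq_zero_of_integral_contDiff_smul_eq_zero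
      (hF.locallyIntegrable.locallyIntegrableOn _) fun g hg _ hgs => ?_
    have hz : ∀ x, x ∉ Set.Ioo c (c + L) → g x = 0 := fun x hx =>
      by_contra fun h0 => hx (hgs (subset_tsupport g h0))
    -- A test function supported in the open interval vanishes at both ends, hence descends to a
    -- continuous function on the circle.
    let G : C(AddCircle L, ℂ) := ⟨AddCircle.liftIco L c (fun x => (g x : ℂ)),
      AddCircle.liftIco_continuous (by simp [hz c (by simp), hz (c + L) (by simp)])
        (by have := hg.continuous; fun_prop)⟩
    rw [← hΦ G]
    refine integral_congr_ae ?_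
    filter_upwards [hsupp] with x hx
    by_cases hxI : x ∈ Set.Ico c (c + L)
    · change _ = AddCircle.liftIco L c (fun x => (g x : ℂ)) x * F x
      rw [AddCircle.liftIco_coe_apply hxI]
      simp
    · simp [hx hxI]
  have h3 : ∀ᵐ x : ℝ, x ≠ c := by simp [ae_iff]
  filter_upwards [hsupp, h2, h3] with x h1 h2 h3
  by_cases hxI : x ∈ Set.Ico c (c + L)
  · exact h2 ⟨lt_of_le_of_ne hxI.1 h3.symm, hxI.2⟩
  · exact h1 hxI

/-! ### Product vectors, and invariance as commutation -/

theorem coeFn_prodVec (f g : HOne) :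
    (prodVec f g : ℝ × ℝ → ℂ) =ᵐ[volume] fun z => f z.1 * g z.2 :=
  MemLp.coeFn_toLp _

theorem coeFn_controlledTranslation (ψ : HBC) :
    (controlledTranslation ψ : ℝ × ℝ → ℂ) =ᵐ[volume] fun z => ψ (z.1 + z.2, z.2) :=
  Lp.coeFn_compMeasurePreserving ψ measurePreserving_shear

theorem coeFn_phase (P : ℝ) (ψ : HBC) : (phase P ψ : ℝ × ℝ → ℂ) =ᵐ[volume]
    fun z => Complex.exp (-(Complex.I * (z.2 : ℂ) * (P : ℂ))) * ψ z :=
  MemLp.coeFn_toLp (memLp_phase P ψ)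

theorem inner_prodVec (u φ v f : HOne) :
    inner ℂ (prodVec u φ) (prodVec v f) = inner ℂ u v * inner ℂ φ f := by
  rw [L2.inner_def, L2.inner_def, L2.inner_def, ← integral_prod_mul]
  refine integral_congr_ae ?_
  filter_upwards [coeFn_prodVec u φ, coeFn_prodVec v f] with z h1 h2
  simp only [h1, h2, RCLike.inner_apply, map_mul]
  ring

theorem inner_controlledTranslation_prodVec (u φ v f : HOne) :
    inner ℂ (prodVec u φ) (controlledTranslation (prodVec v f)) =
      ∫ x, inner ℂ (φ x) (f x) * inner ℂ u (translate x v) := by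
  have hae : (fun z : ℝ × ℝ => inner ℂ (prodVec u φ z) (controlledTranslation (prodVec v f) z))
      =ᵐ[volume] fun z => inner ℂ (φ z.2) (f z.2) * inner ℂ (u z.1) (v (z.1 + z.2)) := by
    filter_upwards [coeFn_prodVec u φ, coeFn_controlledTranslation (prodVec v f),
      measurePreserving_shear.quasiMeasurePreserving.ae (coeFn_prodVec v f)] with z h1 h2 h3
    rw [h1, h2, h3]
    simp only [RCLike.inner_apply, map_mul]
    ring
  have hint := (L2.integrable_inner (𝕜 := ℂ) (prodVec u φ)
    (controlledTranslation (prodVec v f))).congr hae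
  rw [L2.inner_def, integral_congr_ae hae, Measure.volume_eq_prod, integral_prod_symm _ hint]
  refine integral_congr_ae (Eventually.of_forall fun x => ?_)
  simp only
  rw [integral_const_mul, L2.inner_def]
  congr 1
  refine integral_congr_ae ?_
  filter_upwards [coeFn_translate x v] with y hy
  rw [hy]

/-- Pairing with products of indicators shows that ψ has zero integral over rectangles; a π-λ
argument inside each square extends this to Borel sets, and the squares exhaust the plane. -/
theorem eq_zero_of_inner_prodVec {ψ : HTwo} (h : ∀ f g, inner ℂ (prodVec f g) ψ = 0) : ψ = 0 := by
  have hrect : ∀ A B : Set ℝ, MeasurableSet A → MeasurableSet B → volume A ≠ ⊤ → volume B ≠ ⊤ →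
      ∫ z in A ×ˢ B, ψ z = 0 := by
    intro A B hA hB hA' hB'
    have h1 := h (indicatorConstLp 2 hA hA' 1) (indicatorConstLp 2 hB hB' 1)
    rw [L2.inner_def] at h1
    rw [← integral_indicator (hA.prod hB), ← h1]
    refine integral_congr_ae ?_
    filter_upwards [coeFn_prodVec (indicatorConstLp 2 hA hA' 1) (indicatorConstLp 2 hB hB' 1),
      Measure.quasiMeasurePreserving_fst.ae
        (indicatorConstLp_coeFn (p := 2) (hs := hA) (hμs := hA') (c := (1 : ℂ))),
      Measure.quasiMeasurePreserving_snd.ae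
        (indicatorConstLp_coeFn (p := 2) (hs := hB) (hμs := hB') (c := (1 : ℂ)))] with z h1 h2 h3
    rw [h1, h2, h3]
    by_cases h4 : z.1 ∈ A <;> by_cases h5 : z.2 ∈ B <;> simp [h4, h5]
  let K : ℕ → Set ℝ := fun n => Metric.closedBall 0 n
  have hK : ∀ n, volume (K n) ≠ ⊤ := fun n => measure_closedBall_lt_top.ne
  have hKm : ∀ n, MeasurableSet (K n) := fun n => measurableSet_closedBall
  have hK2 : ∀ n, volume (K n ×ˢ K n) ≠ ⊤ := fun n => by
    rw [Measure.volume_eq_prod, Measure.prod_prod]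
    exact ENNReal.mul_ne_top (hK n) (hK n)
  have hint : ∀ n, IntegrableOn ψ (K n ×ˢ K n) := fun n =>
    integrableOn_Lp_of_measure_ne_top ψ (by norm_num) (hK2 n)
  have hall : ∀ n, ∀ s : Set (ℝ × ℝ), MeasurableSet s →
      ∫ z in s, ψ z ∂(volume.restrict (K n ×ˢ K n)) = 0 := by
    intro n s hs
    induction s, hs using MeasurableSpace.induction_on_inter generateFrom_prod.symm
      isPiSystem_prod with
    | empty => simp
    | basic t ht =>
      obtain ⟨A, hA, B, hB, rfl⟩ := ht
      rw [Set.mem_ofPred_eq] at hA hB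
      rw [Measure.restrict_restrict (hA.prod hB), Set.prod_inter_prod]
      exact hrect _ _ (hA.inter (hKm n)) (hB.inter (hKm n))
        (measure_ne_top_of_subset Set.inter_subset_right (hK n))
        (measure_ne_top_of_subset Set.inter_subset_right (hK n))
    | compl t ht iht =>
      have h1 := integral_add_compl ht (hint n)
      rw [iht, zero_add, hrect _ _ (hKm n) (hKm n) (hK n) (hK n)] at h1
      exact h1
    | iUnion f hd hf ih =>
      rw [integral_iUnion hf hd (hint n).integrable.integrableOn]
      simp [ih]
  have hae : ∀ᵐ z, ∀ n, z ∈ K n ×ˢ K n → ψ z = 0 := by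
    rw [ae_all_iff]
    intro n
    rw [← ae_restrict_iff' ((hKm n).prod (hKm n))]
    exact (hint n).integrable.ae_eq_zero_of_forall_setIntegral_eq_zero fun s hs _ => hall n s hs
  refine (Lp.eq_zero_iff_ae_eq_zero).2 ?_
  filter_upwards [hae] with z hz
  obtain ⟨n, hn⟩ := exists_nat_ge (max ‖z.1‖ ‖z.2‖)
  refine hz n ⟨?_, ?_⟩
  · simpa [K] using (le_max_left _ _).trans hn
  · simpa [K] using (le_max_right _ _).trans hn

theorem controlledTranslation_surjective : Function.Surjective controlledTranslation := by
  have hm : MeasurePreserving (fun z : ℝ × ℝ => (z.1 - z.2, z.2)) volume volume :=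
    measurePreserving_sub_prod (volume : Measure ℝ) (volume : Measure ℝ)
  intro ψ
  refine ⟨Lp.compMeasurePreserving _ hm ψ, Lp.ext ?_⟩
  filter_upwards [coeFn_controlledTranslation (Lp.compMeasurePreserving _ hm ψ),
    measurePreserving_shear.quasiMeasurePreserving.ae (Lp.coeFn_compMeasurePreserving ψ hm)]
    with z h1 h2
  rw [h1, h2]
  simp

theorem phase_surjective (P : ℝ) : Function.Surjective (phase P) := by
  intro ψ
  refine ⟨phase (-P) ψ, Lp.ext ?_⟩
  filter_upwards [coeFn_phase P (phase (-P) ψ), coeFn_phase (-P) ψ] with z h1 h2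
  rw [h1, h2, ← mul_assoc, ← Complex.exp_add]
  simp

/-- The parity-swap stands on the outside of both sides and cancels, being an isometry; surjectivity
of W makes its adjoint an inverse. -/
theorem isInvariant_comp_iff {O : HBC →L[ℂ] HBC} (W : HBC →ₗᵢ[ℂ] HBC)
    (hW : Function.Surjective W) :
    IsInvariant (paritySwap ∘L W.toContinuousLinearMap) O ↔ ∀ ψ, W (O ψ) = O (W ψ) := by
  set Q : HBC →ₗᵢ[ℂ] HAB := Lp.compMeasurePreservingₗᵢ ℂ (fun z : ℝ × ℝ => (z.2, -z.1))
    measurePreserving_paritySwap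
  have hQ : paritySwap = Q.toContinuousLinearMap := rfl
  have hadj : ∀ (V : HBC →ₗᵢ[ℂ] HBC) ψ,
      ContinuousLinearMap.adjoint V.toContinuousLinearMap (V ψ) = ψ := fun V ψ =>
    ext_inner_left ℂ fun χ => by
      rw [ContinuousLinearMap.adjoint_inner_right]
      exact V.inner_map_map χ ψ
  rw [IsInvariant, hQ, ContinuousLinearMap.adjoint_comp]
  constructor
  · intro h ψ
    have h1 := DFunLike.congr_fun h (Q (W ψ))
    simp only [ContinuousLinearMap.comp_apply, hadj] at h1
    exact Q.injective h1
  · intro h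
    ext1 χ
    obtain ⟨ψ, hψ⟩ := hW (ContinuousLinearMap.adjoint Q.toContinuousLinearMap χ)
    simp only [ContinuousLinearMap.comp_apply, ← hψ, hadj]
    exact congrArg Q (h ψ)

theorem isInvariant_transform_iff {O : HBC →L[ℂ] HBC} (P : ℝ)
    (hO : IsInvariant standardTransform O) :
    IsInvariant (transform P) O ↔ ∀ ψ, phase P (O ψ) = O (phase P ψ) := by
  have h0 := (isInvariant_comp_iff _ controlledTranslation_surjective).1 hO
  have h1 := isInvariant_comp_iff (O := O) (controlledTranslation.comp (phase P))
    (controlledTranslation_surjective.comp (phase_surjective P))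
  refine Iff.trans h1 (forall_congr' fun ψ => ?_)
  change controlledTranslation (phase P (O ψ)) = O (controlledTranslation (phase P ψ)) ↔ _
  rw [← h0]
  exact controlledTranslation.injective.eq_iff

theorem phase_prodVec (P : ℝ) (v : HOne) {f g : HOne} (hg : (g : ℝ → ℂ) =ᵐ[volume]
    fun x => Complex.exp (-(Complex.I * (x : ℂ) * (P : ℂ))) * f x) :
    phase P (prodVec v f) = prodVec v g := by
  refine Lp.ext ?_
  filter_upwards [coeFn_phase P (prodVec v f), coeFn_prodVec v f, coeFn_prodVec v g,
    Measure.quasiMeasurePreserving_snd.ae hg] with z h1 h2 h3 h4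
  rw [h1, h2, h3, h4]
  ring

theorem exists_coeFn_eq_exp_mul (P : ℝ) (f : HOne) : ∃ g : HOne, (g : ℝ → ℂ) =ᵐ[volume]
    fun x => Complex.exp (-(Complex.I * (x : ℂ) * (P : ℂ))) * f x :=
  exists_coeFn_eq_mul (C := 1) (by fun_prop) (fun x => by rw [Complex.norm_exp]; simp) f

theorem eq_zero_of_sum_mul_inner {n : ℕ} {A : Fin n → (HOne →L[ℂ] HOne)}
    (hA : LinearIndependent ℂ A) {c : Fin n → ℂ}
    (h : ∀ u v, ∑ k, c k * inner ℂ u (A k v) = 0) (k : Fin n) : c k = 0 := by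
  refine Fintype.linearIndependent_iff.1 hA c ?_ k
  ext1 v
  refine ext_inner_left ℂ fun u => ?_
  simpa [sum_apply, inner_sum, inner_smul_right] using h u v

theorem ext_prodVec {A B : HBC →L[ℂ] HBC} (h : ∀ f g, A (prodVec f g) = B (prodVec f g)) :
    A = B := by
  have h1 : ∀ χ, ContinuousLinearMap.adjoint (A - B) χ = 0 := fun χ =>
    eq_zero_of_inner_prodVec fun f g => by
      rw [ContinuousLinearMap.adjoint_inner_right, sub_apply, h, sub_self, inner_zero_left]
  refine sub_eq_zero.1 (ContinuousLinearMap.ext fun ψ => ext_inner_left ℂ fun χ => ?_)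
  rw [← ContinuousLinearMap.adjoint_inner_left, h1]
  simp

section

variable {O : HBC →L[ℂ] HBC} {n : ℕ} {lam : Fin n → ℝ} {OB OC : Fin n → (HOne →L[ℂ] HOne)}

theorem IsSchmidtDecomposition.phase_comm_iff (hS : IsSchmidtDecomposition O lam OB OC) (P : ℝ) :
    (∀ ψ, phase P (O ψ) = O (phase P ψ)) ↔ ∀ k, CommutesWithMul (OC k)
      (fun x => Complex.exp (-(Complex.I * (x : ℂ) * (P : ℂ)))) := by
  constructor
  · intro h k f g hg
    choose e he using fun k => exists_coeFn_eq_exp_mul P (OC k f)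
    have h1 : ∀ k, OC k g = e k := by
      intro k
      refine sub_eq_zero.1 (ext_inner_left ℂ fun φ => ?_)
      rw [inner_zero_right]
      -- Pairing with u ⊗ φ gives a linear relation among the O_B with these coefficients.
      have h2 : ∀ k, (lam k : ℂ) * inner ℂ φ (OC k g - e k) = 0 := by
        refine eq_zero_of_sum_mul_inner hS.linearIndependent_left fun u v => ?_
        have h3 := congrArg (inner ℂ (prodVec u φ)) (h (prodVec v f))
        rw [phase_prodVec P v hg, hS.apply_prodVec, hS.apply_prodVec, map_sum, inner_sum,
          inner_sum] at h3
        simp only [map_smul, phase_prodVec P _ (he _), inner_smul_right, inner_prodVec] at h3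
        rw [eq_comm, ← sub_eq_zero, ← Finset.sum_sub_distrib] at h3
        rw [← h3]
        refine Finset.sum_congr rfl fun k _ => ?_
        rw [inner_sub_right]
        ring
      exact (mul_eq_zero.1 (h2 k)).resolve_left (Complex.ofReal_ne_zero.2 (hS.coeff_pos k).ne')
    rw [h1 k]
    exact he k
  · intro h
    refine DFunLike.congr_fun (ext_prodVec (A := (phase P).toContinuousLinearMap ∘L O)
      (B := O ∘L (phase P).toContinuousLinearMap) fun v f => ?_)
    obtain ⟨g, hg⟩ := exists_coeFn_eq_exp_mul P f
    simp only [ContinuousLinearMap.comp_apply, LinearIsometry.coe_toContinuousLinearMap]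
    rw [phase_prodVec P v hg, hS.apply_prodVec, hS.apply_prodVec, map_sum]
    refine Finset.sum_congr rfl fun k _ => ?_
    rw [map_smul, phase_prodVec P _ (h k f g hg)]

end

/-! ### From periodic functions of position to vanishing matrix elements -/

theorem CommutesWithMul.fourier {T : HOne →L[ℂ] HOne} {P L : ℝ} (hP : P ≠ 0)
    (hL : L = 2 * Real.pi / |P|)
    (h : CommutesWithMul T (fun x => Complex.exp (-(Complex.I * (x : ℂ) * (P : ℂ))))) (j : ℤ) :
    CommutesWithMul T (fun x => fourier j (x : AddCircle L)) := by
  have hpow : ∀ j : ℤ, CommutesWithMul T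
      (fun x => Complex.exp (-(Complex.I * (x : ℂ) * (P : ℂ))) ^ j) := by
    have hn : ∀ n : ℕ, CommutesWithMul T
        (fun x => Complex.exp (-(Complex.I * (x : ℂ) * (P : ℂ))) ^ n) := fun n =>
      h.pow (C := 1) (by fun_prop) (fun x => by rw [Complex.norm_exp]; simp) n
    intro j
    obtain ⟨n, rfl | rfl⟩ := j.eq_nat_or_neg
    · simpa using hn n
    · simpa using (hn n).inv fun x => pow_ne_zero _ (Complex.exp_ne_zero _)
  have hpi : (Real.pi : ℂ) ≠ 0 := Complex.ofReal_ne_zero.2 Real.pi_ne_zero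
  have hPc : (P : ℂ) ≠ 0 := Complex.ofReal_ne_zero.2 hP
  rcases lt_or_gt_of_ne hP with h0 | h0
  · convert hpow j using 2 with x
    rw [fourier_coe_apply, hL, abs_of_neg h0, ← Complex.exp_int_mul]
    congr 1
    push_cast
    field_simp
  · convert hpow (-j) using 2 with x
    rw [fourier_coe_apply, hL, abs_of_pos h0, ← Complex.exp_int_mul]
    congr 1
    push_cast
    field_simp

/-- Inserting Fourier modes into φ turns the equality of integrals into equality of all Fourier
coefficients. One integrand lives on the interval of φ, the other on that of f; the modes do not see
the shift by mL, after which both live on a single period and are determined by their coefficients.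
-/
theorem ae_eq_of_forall_sum_integral_eq {n : ℕ} {OC : Fin n → (HOne →L[ℂ] HOne)} {L : ℝ}
    (hL : 0 < L)
    (hOC : ∀ k (j : ℤ), CommutesWithMul (OC k) (fun x => fourier j (x : AddCircle L)))
    {K K' : Fin n → ℝ → ℂ} (hK : ∀ k, Continuous (K k)) (hK' : ∀ k, Continuous (K' k))
    {C C' : Fin n → ℝ} (hC : ∀ k x, ‖K k x‖ ≤ C k) (hC' : ∀ k x, ‖K' k x‖ ≤ C' k)
    {c : ℝ} {m : ℤ} {φ f : HOne} (hφ : ∀ᵐ x, x ∉ Set.Ico c (c + L) → φ x = 0)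
    (hf : ∀ᵐ x, x ∉ Set.Ico (c + m * L) (c + m * L + L) → f x = 0)
    (h : ∀ φ : HOne, ∑ k, ∫ x, inner ℂ (φ x) (OC k f x) * K k x =
      ∑ k, ∫ x, inner ℂ (OC k φ x) (f x) * K' k x) :
    ∀ᵐ x, ∑ k, inner ℂ (φ x) (OC k f x) * K k x =
      ∑ k, inner ℂ (OC k φ (x + m * L)) (f (x + m * L)) * K' k (x + m * L) := by
  have : Fact (0 < L) := ⟨hL⟩
  have hG : ∀ φ : HOne, ∀ k, Integrable fun x => inner ℂ (φ x) (OC k f x) * K k x := fun φ k =>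
    (L2.integrable_inner (𝕜 := ℂ) φ (OC k f)).mul_bdd (hK k).aestronglyMeasurable
      (Eventually.of_forall (hC k))
  have hH : ∀ φ : HOne, ∀ k, Integrable fun x => inner ℂ (OC k φ x) (f x) * K' k x := fun φ k =>
    (L2.integrable_inner (𝕜 := ℂ) (OC k φ) f).mul_bdd (hK' k).aestronglyMeasurable
      (Eventually.of_forall (hC' k))
  set G : ℝ → ℂ := fun x => ∑ k, inner ℂ (φ x) (OC k f x) * K k x with hGdef
  set H : ℝ → ℂ := fun x => ∑ k, inner ℂ (OC k φ x) (f x) * K' k x with hHdef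
  have hGi : Integrable G := integrable_finsetSum _ fun k _ => hG φ k
  have hHi : Integrable H := integrable_finsetSum _ fun k _ => hH φ k
  have hfour : ∀ j : ℤ, ∫ x : ℝ, fourier j (x : AddCircle L) * G x =
      ∫ x : ℝ, fourier j (x : AddCircle L) * H x := by
    intro j
    have hcont : Continuous fun x : ℝ => fourier (-j) (x : AddCircle L) :=
      (fourier (-j)).continuous.comp (AddCircle.continuous_mk' L)
    -- Conjugation in the first argument of the inner product turns mode -j into mode j.
    obtain ⟨φ', hφ'⟩ := exists_coeFn_eq_mul hcont.measurable
      (fun x => (fourier (-j)).norm_coe_le_norm (x : AddCircle L)) φ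
    have h1 := h φ'
    rw [← integral_finsetSum _ fun k _ => hG φ' k, ← integral_finsetSum _ fun k _ => hH φ' k] at h1
    convert h1 using 1
    · refine integral_congr_ae ?_
      filter_upwards [hφ'] with x hx
      simp only [hGdef, hx, Finset.mul_sum, RCLike.inner_apply, map_mul, fourier_neg,
        RCLike.conj_conj]
      exact Finset.sum_congr rfl fun k _ => by ring
    · refine integral_congr_ae ?_
      filter_upwards [ae_all_iff.2 fun k => hOC k (-j) φ φ' hφ'] with x hx
      simp only [hHdef, hx, Finset.mul_sum, RCLike.inner_apply, map_mul, fourier_neg,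
        RCLike.conj_conj]
      exact Finset.sum_congr rfl fun k _ => by ring
  have hshift : ∀ x : ℝ, ((x + m * L : ℝ) : AddCircle L) = x := fun x => by
    rw [← zsmul_eq_mul, AddCircle.coe_add, AddCircle.coe_zsmul, AddCircle.coe_period, smul_zero,
      add_zero]
  have hHi' : Integrable fun x => H (x + m * L) := hHi.comp_add_right (m * L)
  have hz := ae_eq_zero_of_fourier_integral_eq_zero hL c (F := fun x => G x - H (x + m * L))
    (hGi.sub hHi') ?_ ?_
  · filter_upwards [hz] with x hx
    exact sub_eq_zero.1 hx
  · filter_upwards [hφ, (measurePreserving_add_right volume (m * L)).quasiMeasurePreserving.ae hf]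
      with x h1 h2 hx
    have h3 : x + m * L ∉ Set.Ico (c + m * L) (c + m * L + L) := fun h3 =>
      hx ⟨by linarith [h3.1], by linarith [h3.2]⟩
    simp [hGdef, hHdef, h1 hx, h2 h3]
  · intro j
    have hb : ∀ {F : ℝ → ℂ}, Integrable F →
        Integrable fun x : ℝ => fourier j (x : AddCircle L) * F x := fun hF =>
      hF.bdd_mul (c := ‖(fourier j : C(AddCircle L, ℂ))‖)
        ((fourier j).continuous.comp (AddCircle.continuous_mk' L)).aestronglyMeasurable
        (Eventually.of_forall fun x => (fourier j).norm_coe_le_norm _)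
    simp only [mul_sub]
    rw [integral_sub (hb hGi) (hb hHi'), hfour, sub_eq_zero]
    rw [← integral_add_right_eq_self (fun x : ℝ => fourier j (x : AddCircle L) * H x) (m * L)]
    simp only [hshift]

section

variable {O : HBC →L[ℂ] HBC} {n : ℕ} {lam : Fin n → ℝ} {OB OC : Fin n → (HOne →L[ℂ] HOne)}

theorem continuous_inner_translate (u v : HOne) : Continuous fun x => inner ℂ u (translate x v) :=
  continuous_const.inner (continuous_translate v)

theorem norm_inner_translate_le (u v : HOne) (x : ℝ) : ‖inner ℂ u (translate x v)‖ ≤ ‖u‖ * ‖v‖ :=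
  (norm_inner_le_norm _ _).trans (by rw [LinearIsometry.norm_map])

/-- L² is separable: countably many null sets suffice for a dense family, and continuity covers the
remaining vectors. -/
theorem ae_forall_of_dense {p q : ℝ → HOne → HOne → ℂ}
    (hp : ∀ x, Continuous fun z : HOne × HOne => p x z.1 z.2)
    (hq : ∀ x, Continuous fun z : HOne × HOne => q x z.1 z.2)
    (h : ∀ u v, ∀ᵐ x, p x u v = q x u v) : ∀ᵐ x, ∀ u v, p x u v = q x u v := by
  have : Fact ((2 : ENNReal) ≠ ⊤) := ⟨by simp⟩
  let d := TopologicalSpace.denseSeq HOne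
  have hd : DenseRange d := TopologicalSpace.denseRange_denseSeq HOne
  have h1 : ∀ᵐ x, ∀ i j, p x (d i) (d j) = q x (d i) (d j) :=
    ae_all_iff.2 fun i => ae_all_iff.2 fun j => h _ _
  filter_upwards [h1] with x hx u v
  exact congrFun ((hd.prodMap hd).equalizer (hp x) (hq x) (funext fun z => hx z.1 z.2)) (u, v)

theorem inner_apply_eq_inner_of_isSelfAdjoint (hO : IsSelfAdjoint O) (ψ χ : HBC) :
    inner ℂ ψ (O χ) = inner ℂ (O ψ) χ := by
  rw [← ContinuousLinearMap.adjoint_inner_left, hO.adjoint_eq]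

/-- This is commutation with the controlled translation, tested on product vectors, with O moved to
the left vector on one side by self-adjointness. -/
theorem IsSchmidtDecomposition.ae_slice_translate (hS : IsSchmidtDecomposition O lam OB OC)
    (hO : IsSelfAdjoint O)
    (hU : ∀ ψ, controlledTranslation (O ψ) = O (controlledTranslation ψ)) {L : ℝ} (hL : 0 < L)
    (hOC : ∀ k (j : ℤ), CommutesWithMul (OC k) (fun x => fourier j (x : AddCircle L)))
    {c : ℝ} {m : ℤ} {φ f : HOne}
    (hφ : ∀ᵐ x, x ∉ Set.Ico c (c + L) → φ x = 0)
    (hf : ∀ᵐ x, x ∉ Set.Ico (c + m * L) (c + m * L + L) → f x = 0) :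
    ∀ᵐ x, ∀ u v,
      ∑ k, inner ℂ (φ x) (OC k f x) * ((lam k : ℂ) * inner ℂ u (translate x (OB k v))) =
      ∑ k, inner ℂ (OC k φ (x + m * L)) (f (x + m * L)) *
        ((lam k : ℂ) * inner ℂ (OB k u) (translate (x + m * L) v)) := by
  refine ae_forall_of_dense ?_ ?_ fun u v => ?_
  · intro x
    have := (translate x).continuous
    fun_prop
  · intro x
    have := (translate (x + m * L)).continuous
    fun_prop
  refine ae_eq_of_forall_sum_integral_eq hL hOC
    (K := fun k x => (lam k : ℂ) * inner ℂ u (translate x (OB k v)))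
    (K' := fun k x => (lam k : ℂ) * inner ℂ (OB k u) (translate x v))
    (fun k => continuous_const.mul (continuous_inner_translate _ _))
    (fun k => continuous_const.mul (continuous_inner_translate _ _))
    (C := fun k => ‖(lam k : ℂ)‖ * (‖u‖ * ‖OB k v‖))
    (C' := fun k => ‖(lam k : ℂ)‖ * (‖OB k u‖ * ‖v‖)) ?_ ?_ hφ hf fun φ => ?_
  · intro k x
    rw [norm_mul]
    gcongr
    exact norm_inner_translate_le _ _ _
  · intro k x
    rw [norm_mul]
    gcongr
    exact norm_inner_translate_le _ _ _
  have h2 := inner_apply_eq_inner_of_isSelfAdjoint hO (prodVec u φ)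
    (controlledTranslation (prodVec v f))
  rw [← hU, hS.apply_prodVec, hS.apply_prodVec, map_sum, inner_sum, sum_inner] at h2
  simp only [map_smul, inner_smul_right, inner_smul_left, inner_controlledTranslation_prodVec,
    Complex.conj_ofReal, ← integral_const_mul] at h2
  have e : ∀ a b c : ℂ, a * (b * c) = b * (a * c) := fun a b c => by ring
  simp only [fun (x : ℝ) (φ f : HOne) (k : Fin n) (c : ℂ) =>
    e (inner ℂ (φ x) (f x)) (lam k : ℂ) c]
  exact h2

/-- The same comparison without the controlled translation; it serves to eliminate O_C φ in favour
of O_C f. -/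
theorem IsSchmidtDecomposition.ae_slice (hS : IsSchmidtDecomposition O lam OB OC)
    (hO : IsSelfAdjoint O) {L : ℝ} (hL : 0 < L)
    (hOC : ∀ k (j : ℤ), CommutesWithMul (OC k) (fun x => fourier j (x : AddCircle L)))
    {c : ℝ} {m : ℤ} {φ f : HOne}
    (hφ : ∀ᵐ x, x ∉ Set.Ico c (c + L) → φ x = 0)
    (hf : ∀ᵐ x, x ∉ Set.Ico (c + m * L) (c + m * L + L) → f x = 0) :
    ∀ᵐ x, ∀ u v, ∑ k, inner ℂ (φ x) (OC k f x) * ((lam k : ℂ) * inner ℂ u (OB k v)) =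
      ∑ k, inner ℂ (OC k φ (x + m * L)) (f (x + m * L)) *
        ((lam k : ℂ) * inner ℂ (OB k u) v) := by
  refine ae_forall_of_dense (fun x => by fun_prop) (fun x => by fun_prop) fun u v => ?_
  refine ae_eq_of_forall_sum_integral_eq hL hOC
    (K := fun k _ => (lam k : ℂ) * inner ℂ u (OB k v))
    (K' := fun k _ => (lam k : ℂ) * inner ℂ (OB k u) v)
    (fun k => continuous_const) (fun k => continuous_const)
    (fun k x => le_rfl) (fun k x => le_rfl) hφ hf fun φ => ?_
  have h2 := inner_apply_eq_inner_of_isSelfAdjoint hO (prodVec u φ) (prodVec v f)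
  rw [hS.apply_prodVec, hS.apply_prodVec, inner_sum, sum_inner] at h2
  simp only [inner_smul_right, inner_smul_left, inner_prodVec, Complex.conj_ofReal] at h2
  simp only [integral_mul_const, ← L2.inner_def]
  have e : ∀ a b c : ℂ, a * (b * c) = b * (c * a) := fun a b c => by ring
  simp only [e (inner ℂ φ _), e (inner ℂ _ f)]
  exact h2

/-- If `O` commutes with `e^{i x̂_C p̂_B}` and the `O_C⁽ᵏ⁾` commute with the `L`-periodic functions of
`x̂_C`, then the `O_C⁽ᵏ⁾` have no matrix elements between an interval of length `L` and its
translates by nonzero multiples of `L`. -/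
theorem IsSchmidtDecomposition.inner_apply_eq_zero (hS : IsSchmidtDecomposition O lam OB OC)
    (hO : IsSelfAdjoint O)
    (hU : ∀ ψ, controlledTranslation (O ψ) = O (controlledTranslation ψ)) {L : ℝ} (hL : 0 < L)
    (hOC : ∀ k (j : ℤ), CommutesWithMul (OC k) (fun x => fourier j (x : AddCircle L)))
    {c : ℝ} {m : ℤ} (hm : m ≠ 0) {φ f : HOne}
    (hφ : ∀ᵐ x, x ∉ Set.Ico c (c + L) → φ x = 0)
    (hf : ∀ᵐ x, x ∉ Set.Ico (c + m * L) (c + m * L + L) → f x = 0) (k : Fin n) :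
    inner ℂ φ (OC k f) = 0 := by
  set B : ℝ → HOne →L[ℂ] HOne :=
    fun x => ∑ k, ((lam k : ℂ) * inner ℂ (φ x) (OC k f x)) • OB k with hB
  have h3 : ∀ᵐ x, Intertwines x (x + m * L) (B x) := by
    filter_upwards [hS.ae_slice_translate hO hU hL hOC hφ hf, hS.ae_slice hO hL hOC hφ hf]
      with x h1 h2 v
    refine ext_inner_left ℂ fun u => ?_
    -- Using the second relation at T_{x+mL} v replaces its right-hand side by B(x) T_{x+mL}.
    have h4 := (h1 u v).trans (h2 u (translate (x + m * L) v)).symm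
    simp only [hB, sum_apply, smul_apply, map_sum, map_smul, inner_sum, inner_smul_right]
    simp only [mul_comm (lam _ : ℂ), mul_assoc] at h4 ⊢
    exact h4
  set S : Set ℝ := {x | Intertwines x (x + m * L) (B x) ∧ x + m * L ≠ 0 ∧ B x ≠ 0}
  have hSfin : S.Finite := by
    have hli : LinearIndependent ℂ fun x : S => B x := by
      refine linearIndependent_of_intertwines (a := fun x : S => (x : ℝ))
        (b := fun x : S => x + m * L) (fun x => x.2.1) (fun x => x.2.2.2) (fun x => x.2.2.1) ?_
      intro x y hxy heq
      -- Equal ratios x/(x+mL) and y/(y+mL) would force (x - y) mL = 0; this is where m ≠ 0 enters.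
      have h5 : (x - y : ℝ) * (m * L) = 0 := by linear_combination heq
      have h6 : (m * L : ℝ) ≠ 0 := mul_ne_zero (Int.cast_ne_zero.2 hm) hL.ne'
      exact hxy (Subtype.ext (sub_eq_zero.1 ((mul_eq_zero.1 h5).resolve_right h6)))
    refine Set.finite_coe_iff.1 (hli.finite_of_le_span_finite _ (Set.range OB) ?_)
    rintro _ ⟨x, rfl⟩
    exact Submodule.sum_mem _ fun k _ =>
      Submodule.smul_mem _ _ (Submodule.subset_span (Set.mem_range_self k))
  have hSae : ∀ᵐ x, x ∉ S := measure_eq_zero_iff_ae_notMem.1 (hSfin.measure_zero _)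
  have hne : ∀ᵐ x : ℝ, x + m * L ≠ 0 := by
    have : ∀ᵐ x : ℝ, x ≠ -(m * L) := by simp [ae_iff]
    filter_upwards [this] with x hx h0 using hx (eq_neg_of_add_eq_zero_left h0)
  rw [L2.inner_def]
  refine integral_eq_zero_of_ae ?_
  filter_upwards [h3, hSae, hne] with x h4 h5 h6
  have h7 : B x = 0 := by_contra fun h0 => h5 ⟨h4, h6, h0⟩
  have h8 := Fintype.linearIndependent_iff.1 hS.linearIndependent_left _ h7 k
  exact (mul_eq_zero.1 h8).resolve_left (Complex.ofReal_ne_zero.2 (hS.coeff_pos k).ne')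

end

end QRF

theorem theorem1 (P : ℝ) (hP : P ≠ 0) (O : QRF.HBC →L[ℂ] QRF.HBC) (hO : IsSelfAdjoint O)
    (n : ℕ) (lam : Fin n → ℝ) (OB OC : Fin n → (QRF.HOne →L[ℂ] QRF.HOne))
    (hSchmidt : QRF.IsSchmidtDecomposition O lam OB OC)
    (hinv : QRF.IsInvariant QRF.standardTransform O) :
    QRF.IsInvariant (QRF.transform P) O ↔
      ∀ k : Fin n, QRF.CommutesWith QRF.position (OC k) := by
  rw [QRF.isInvariant_transform_iff P hinv, hSchmidt.phase_comm_iff P]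
  simp only [QRF.commutesWith_position_iff]
  refine ⟨fun h k => ?_, fun h k => (h k).exp_of_position P⟩
  have hU := (QRF.isInvariant_comp_iff _ QRF.controlledTranslation_surjective).1 hinv
  have hL : 0 < 2 * Real.pi / |P| := div_pos Real.two_pi_pos (abs_pos.2 hP)
  exact QRF.CommutesWithMul.position_of_blocks hL fun c m hm φ f hφ hf =>
    hSchmidt.inner_apply_eq_zero hO hU hL (fun k => (h k).fourier hP rfl) hm hφ hf k
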